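/- Let $d\ge 0$ be an integer. For a Borel probability measure $\mu$ on $\mathbb{R}^d$ and $t\ge 0$, let the wet part be \[ W_t^{\mu}=\{x\in\mathbb{R}^d : \text{there is a closed halfspace } h \text{ with } x\in h \text{ and } \mu(h)\le t\}, \] and let $w^{\mu}(t)=\mu(W_t^{\mu})$. Let $P_n^{\mu}$ be the convex hull of $n$ independent random points, each distributed according to $\mu$. Then there is a sequence $\varepsilon_d(n)$ of real numbers, depending only on $d$ (and not on $\mu$), with $\varepsilon_d(n)\to 0$ as $n\to\infty$, such that for every Borel probability measure $\mu$ on $\mathbb{R}^d$ and every integer $n\ge 2$ \[ \tfrac14\, w^{\mu}\bigl(\tfrac1n\bigr)\ \le\ \mathbb{E}\bigl[1-\mu(P_n^{\mu})\bigr]\ \le\ w^{\mu}\bigl((d+2)\tfrac{\ln n}{n}\bigr)+\frac{\varepsilon_d(n)}{n}. \] -/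

import Mathlib

open MeasureTheory Filter Topology

noncomputable section

/-- A closed halfspace of `ℝ^d`: `{x | c ≤ ⟨u, x⟩}` for some nonzero vector `u` and real `c`. -/
def IsClosedHalfspace {d : ℕ} (h : Set (EuclideanSpace ℝ (Fin d))) : Prop :=
  ∃ u : EuclideanSpace ℝ (Fin d), u ≠ 0 ∧ ∃ c : ℝ, h = {x | c ≤ inner ℝ u x}

/-- The wet part of `μ` with parameter `t`: the union of all closed halfspaces of `μ`-measure
at most `t`. -/
def wetPart {d : ℕ} (μ : Measure (EuclideanSpace ℝ (Fin d))) (t : ℝ) :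
    Set (EuclideanSpace ℝ (Fin d)) :=
  {x | ∃ h : Set (EuclideanSpace ℝ (Fin d)), IsClosedHalfspace h ∧ x ∈ h ∧ μ.real h ≤ t}

/-- The `μ`-measure of the wet part. -/
def wetMeasure {d : ℕ} (μ : Measure (EuclideanSpace ℝ (Fin d))) (t : ℝ) : ℝ :=
  μ.real (wetPart μ t)

/-- The law of a sample of `n` independent points of `ℝ^d`, each distributed according to `μ`. -/
def sampleLaw {d : ℕ} (μ : Measure (EuclideanSpace ℝ (Fin d))) (n : ℕ) :
    Measure (Fin n → EuclideanSpace ℝ (Fin d)) :=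
  Measure.pi fun _ => μ

/-- The polytope spanned by a sample: the convex hull of its points. -/
def samplePolytope {d n : ℕ} (X : Fin n → EuclideanSpace ℝ (Fin d)) :
    Set (EuclideanSpace ℝ (Fin d)) :=
  convexHull ℝ (Set.range X)

end

/-!
By Tonelli, the expected mass missed by the sample polytope is the average over `x` of the
probability that the polytope misses `x`.

If `x` is wet, lying in a halfspace of measure at most `1 / n`, then all `n` points avoid that
halfspace with probability at least `(1 - 1 / n) ^ n ≥ 1 / 4`, and then the polytope misses `x`.

Suppose that `x` is dry, so that every closed halfspace containing `x` has measure greater than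
`t`. When the polytope misses `x`, its point `p` nearest to `x` is a convex combination of at most
`d` sample points, by Carathéodory's theorem in the face of the polytope through `p`. These points
determine `p`, hence also an open halfspace, with `x` on its boundary, that must contain the other
`n - d` points. A union bound over the choice of the `d` points gives the probability
`n.choose d * (1 - t) ^ (n - d)`, which is `O(n⁻²)` for `t = (d + 2) log n / n`.
-/

section ConvexHull

variable {E ι : Type*} [AddCommGroup E] [Module ℝ E]

theorem mem_convexHull_range_iff_exists_stdSimplex [Fintype ι] {X : ι → E} {x : E} :
    x ∈ convexHull ℝ (Set.range X) ↔ ∃ w ∈ stdSimplex ℝ ι, ∑ i, w i • X i = x := by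
  classical
  have hX : Set.range X =
      Fintype.linearCombination ℝ X '' Set.range fun i => (Pi.single i 1 : ι → ℝ) := by
    rw [← Set.range_comp]
    congr 1
    ext i
    simp [Fintype.linearCombination_apply_single]
  rw [hX, ← LinearMap.image_convexHull, convexHull_rangle_single_eq_stdSimplex]
  simp [Fintype.linearCombination_apply]

theorem isClosed_setOf_exists_mem_convexHull_range [Finite ι] [TopologicalSpace E]
    [ContinuousAdd E] [ContinuousSMul ℝ E] {Y : Type*} [TopologicalSpace Y] {F : Y → ι → E}
    (hF : Continuous F) {C : Set (E × Y)} (hC : IsClosed C) :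
    IsClosed {y | ∃ p ∈ convexHull ℝ (Set.range (F y)), (p, y) ∈ C} := by
  cases nonempty_fintype ι
  have hcomb : Continuous fun r : stdSimplex ℝ ι × Y => (∑ i, r.1.1 i • F r.2 i, r.2) := by
    refine Continuous.prodMk (continuous_finsetSum _ fun i _ => ?_) continuous_snd
    exact ((continuous_apply i).comp (continuous_subtype_val.comp continuous_fst)).smul
      (by fun_prop)
  -- The weights range over a compact set, so projecting them away is a closed map.
  convert isClosedMap_snd_of_compactSpace _ (hC.preimage hcomb) using 1
  ext y
  simp [mem_convexHull_range_iff_exists_stdSimplex]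

end ConvexHull

section NearestPoint

variable {E : Type*} [NormedAddCommGroup E] [InnerProductSpace ℝ E]

theorem exists_mem_forall_inner_sub_nonneg {K : Set E} (hne : K.Nonempty) (hK : IsComplete K)
    (hconv : Convex ℝ K) (x : E) : ∃ p ∈ K, ∀ y ∈ K, 0 ≤ inner ℝ (p - x) (y - p) := by
  obtain ⟨p, hp, hmin⟩ := exists_norm_eq_iInf_of_complete_convex hne hK hconv x
  refine ⟨p, hp, fun y hy => ?_⟩
  rw [← neg_sub x p, inner_neg_left, neg_nonneg]
  exact (norm_eq_iInf_iff_real_inner_le_zero hconv hp).1 hmin y hy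

theorem inner_sub_nonneg_of_mem_convexHull {s : Set E} {u p q : E}
    (h : ∀ y ∈ s, 0 ≤ inner ℝ u (y - p)) (hq : q ∈ convexHull ℝ s) : 0 ≤ inner ℝ u (q - p) := by
  simp only [inner_sub_right, sub_nonneg] at h ⊢
  exact convexHull_min h (convex_halfSpace_ge (innerₛₗ ℝ u).isLinear _) hq

theorem eq_of_forall_inner_sub_nonneg {s : Set E} {x p q : E} (hp : p ∈ convexHull ℝ s)
    (hq : q ∈ convexHull ℝ s) (hps : ∀ y ∈ s, 0 ≤ inner ℝ (p - x) (y - p))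
    (hqs : ∀ y ∈ s, 0 ≤ inner ℝ (q - x) (y - q)) : p = q := by
  have hpq := inner_sub_nonneg_of_mem_convexHull hps hq
  have hqp := inner_sub_nonneg_of_mem_convexHull hqs hp
  have hle : inner ℝ (p - q) (p - q) ≤ 0 := by
    simp only [inner_sub_left, inner_sub_right] at hpq hqp ⊢
    linarith
  exact sub_eq_zero.1 (real_inner_self_nonpos.1 hle)

theorem notMem_convexHull_of_forall_inner_sub_nonneg {s : Set E} {x p : E} (hpx : p ≠ x)
    (h : ∀ y ∈ s, 0 ≤ inner ℝ (p - x) (y - p)) : x ∉ convexHull ℝ s := by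
  intro hx
  have hneg := inner_sub_nonneg_of_mem_convexHull h hx
  rw [← neg_sub p x, inner_neg_right, neg_nonneg] at hneg
  exact hpx (sub_eq_zero.1 (real_inner_self_nonpos.1 hneg))

theorem inner_sub_eq_zero_of_sum_smul_eq {κ : Type*} [Fintype κ] {w : κ → ℝ} {z : κ → E}
    {u p : E} (hw : ∀ i, 0 < w i) (hw1 : ∑ i, w i = 1) (hp : ∑ i, w i • z i = p)
    (h : ∀ i, 0 ≤ inner ℝ u (z i - p)) (i : κ) : inner ℝ u (z i - p) = 0 := by
  have hsum : ∑ i, w i * inner ℝ u (z i - p) = 0 := by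
    simp_rw [← inner_smul_right, ← inner_sum, smul_sub, Finset.sum_sub_distrib,
      ← Finset.sum_smul, hw1, hp, one_smul, sub_self, inner_zero_right]
  rw [Finset.sum_eq_zero_iff_of_nonneg fun i _ => mul_nonneg (hw i).le (h i)] at hsum
  exact (mul_eq_zero.1 (hsum i (Finset.mem_univ i))).resolve_left (hw i).ne'

theorem card_le_finrank_of_inner_sub_eq_zero [FiniteDimensional ℝ E] {κ : Type*} [Fintype κ]
    {z : κ → E} {u p : E} (hz : AffineIndependent ℝ z) (hu : u ≠ 0)
    (h : ∀ i, inner ℝ u (z i - p) = 0) : Fintype.card κ ≤ Module.finrank ℝ E := by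
  have hspan : vectorSpan ℝ (Set.range z) ≤ (ℝ ∙ u)ᗮ := by
    rw [vectorSpan, Submodule.span_le]
    rintro _ ⟨_, ⟨i, rfl⟩, _, ⟨j, rfl⟩, rfl⟩
    have hij : inner ℝ u (z i - z j) = 0 := by
      rw [← sub_sub_sub_cancel_right _ _ p, inner_sub_right, h, h, sub_zero]
    simpa [Submodule.mem_orthogonal_singleton_iff_inner_right] using hij
  have hlt : Module.finrank ℝ (ℝ ∙ u)ᗮ < Module.finrank ℝ E := by
    have hadd := (ℝ ∙ u).finrank_add_finrank_orthogonal
    rw [finrank_span_singleton hu] at hadd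
    lia
  calc Fintype.card κ ≤ Module.finrank ℝ (vectorSpan ℝ (Set.range z)) + 1 :=
        hz.card_le_finrank_succ
    _ ≤ Module.finrank ℝ (ℝ ∙ u)ᗮ + 1 := by gcongr; exact Submodule.finrank_mono hspan
    _ ≤ Module.finrank ℝ E := hlt

theorem exists_finset_card_le_finrank_mem_convexHull_image [FiniteDimensional ℝ E] {ι : Type*}
    {X : ι → E} {u p : E} (hu : u ≠ 0) (hp : p ∈ convexHull ℝ (Set.range X))
    (h : ∀ j, 0 ≤ inner ℝ u (X j - p)) :
    ∃ I : Finset ι, I.card ≤ Module.finrank ℝ E ∧ p ∈ convexHull ℝ (X '' I) := by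
  classical
  obtain ⟨κ, _, z, w, hz, hind, hw, hw1, hwp⟩ := eq_pos_convex_span_of_mem_convexHull hp
  choose f hf using fun i => hz ⟨i, rfl⟩
  have hface : ∀ i, inner ℝ u (z i - p) = 0 :=
    inner_sub_eq_zero_of_sum_smul_eq hw hw1 hwp fun i => hf i ▸ h (f i)
  refine ⟨Finset.univ.image f,
    Finset.card_image_le.trans (card_le_finrank_of_inner_sub_eq_zero hind hu hface), ?_⟩
  exact mem_convexHull_of_exists_fintype w z (fun i => (hw i).le) hw1
    (fun i => ⟨f i, by simp, hf i⟩) hwp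

end NearestPoint

section NearestPointEvent

variable {E : Type*} [NormedAddCommGroup E] [InnerProductSpace ℝ E] {ι : Type*}

/-- The samples `X` whose convex hull misses `x` and has its point nearest to `x` in the convex
hull of the points with index in `I`. The nearest point `p` is encoded by its variational
inequality, which together with `p ≠ x` also expresses that the convex hull misses `x`. -/
def nearestPointEvent (x : E) (I : Finset ι) : Set (ι → E) :=
  {X | ∃ p ∈ convexHull ℝ (X '' I), p ≠ x ∧ ∀ j, 0 ≤ inner ℝ (p - x) (X j - p)}

theorem exists_mem_nearestPointEvent [FiniteDimensional ℝ E] [Fintype ι] [Nonempty ι]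
    (hcard : Module.finrank ℝ E ≤ Fintype.card ι) {x : E} {X : ι → E}
    (hx : x ∉ convexHull ℝ (Set.range X)) :
    ∃ I : Finset ι, I.card = Module.finrank ℝ E ∧ X ∈ nearestPointEvent x I := by
  obtain ⟨p, hp, hmin⟩ := exists_mem_forall_inner_sub_nonneg
    (Set.range_nonempty X).convexHull ((Set.finite_range X).isCompact_convexHull ℝ).isComplete
    (convex_convexHull ℝ _) x
  have hpx : p ≠ x := fun h => hx (h ▸ hp)
  have hsample (j : ι) : 0 ≤ inner ℝ (p - x) (X j - p) :=
    hmin _ (subset_convexHull ℝ _ ⟨j, rfl⟩)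
  obtain ⟨J, hJ, hpJ⟩ :=
    exists_finset_card_le_finrank_mem_convexHull_image (sub_ne_zero.2 hpx) hp hsample
  obtain ⟨I, hJI, hI⟩ := Finset.exists_superset_card_eq hJ hcard
  exact ⟨I, hI, p, convexHull_mono (Set.image_mono hJI) hpJ, hpx, hsample⟩

theorem exists_halfspace_of_mem_nearestPointEvent {x : E} {I : Finset ι} {X₀ : ι → E}
    (h₀ : X₀ ∈ nearestPointEvent x I) :
    ∃ u : E, u ≠ 0 ∧ ∀ X ∈ nearestPointEvent x I, Set.EqOn X X₀ I →
      ∀ j, inner ℝ u (X j) < inner ℝ u x := by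
  obtain ⟨p, hp, hpx, hX₀⟩ := h₀
  refine ⟨x - p, sub_ne_zero.2 hpx.symm, ?_⟩
  rintro X ⟨q, hq, -, hX⟩ hXX₀ j
  rw [hXX₀.image_eq] at hq
  obtain rfl : p = q := by
    refine eq_of_forall_inner_sub_nonneg (x := x) hp hq (Set.forall_mem_image.2 fun i _ => hX₀ i)
      (Set.forall_mem_image.2 fun i hi => ?_)
    exact hXX₀ hi ▸ hX i
  have hpos : 0 < inner ℝ (p - x) (p - x) := real_inner_self_pos.2 (sub_ne_zero.2 hpx)
  have hj := hX j
  simp only [inner_sub_left, inner_sub_right] at hpos hj ⊢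
  linarith

theorem measurableSet_nearestPointEvent [MeasurableSpace E] [BorelSpace E]
    [SecondCountableTopology E] [Finite ι] (x : E) (I : Finset ι) :
    MeasurableSet (nearestPointEvent x I) := by
  have hmiss : IsClosed {X : ι → E | x ∈ convexHull ℝ (Set.range X)} := by
    simpa using isClosed_setOf_exists_mem_convexHull_range (F := fun X : ι → E => X)
      continuous_id (C := {r | r.1 = x}) (isClosed_eq (by fun_prop) (by fun_prop))
  have hnear : IsClosed {X : ι → E | ∃ p ∈ convexHull ℝ (X '' I),
      ∀ j, 0 ≤ inner ℝ (p - x) (X j - p)} := by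
    simp only [Set.image_eq_range]
    refine isClosed_setOf_exists_mem_convexHull_range (F := fun (X : ι → E) (i : I) => X i)
      (by fun_prop) (C := {r | ∀ j, 0 ≤ inner ℝ (r.1 - x) (r.2 j - r.1)}) ?_
    simp only [Set.ofPred_forall]
    exact isClosed_iInter fun j => isClosed_le (by fun_prop) (by fun_prop)
  convert hmiss.isOpen_compl.measurableSet.inter hnear.measurableSet using 1
  ext X
  constructor
  · rintro ⟨p, hp, hpx, hX⟩
    exact ⟨notMem_convexHull_of_forall_inner_sub_nonneg hpx (Set.forall_mem_range.2 hX),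
      p, hp, hX⟩
  · rintro ⟨hx, p, hp, hX⟩
    exact ⟨p, hp, fun hpx => hx (hpx ▸ convexHull_mono (Set.image_subset_range _ _) hp), hX⟩

end NearestPointEvent

section ProductMeasure

open scoped ENNReal

theorem pi_le_pow_of_forall_section {α ι : Type*} [MeasurableSpace α] [Fintype ι]
    {μ : Measure α} [IsProbabilityMeasure μ] {S : Set (ι → α)} (hS : MeasurableSet S)
    (I : Finset ι) {c : ℝ≥0∞}
    (h : ∀ X₀ ∈ S, ∃ A, μ A ≤ c ∧ ∀ X ∈ S, Set.EqOn X X₀ I → ∀ j ∉ I, X j ∈ A) :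
    Measure.pi (fun _ => μ) S ≤ c ^ (Fintype.card ι - I.card) := by
  classical
  set e := MeasurableEquiv.piEquivPiSubtypeProd (fun _ : ι => α) (· ∈ I)
  have hfiber (a : {i // i ∈ I} → α) :
      Measure.pi (fun _ : {i // i ∉ I} => μ) (Prod.mk a ⁻¹' (e.symm ⁻¹' S)) ≤
        c ^ (Fintype.card ι - I.card) := by
    rcases Set.eq_empty_or_nonempty (Prod.mk a ⁻¹' (e.symm ⁻¹' S)) with hempty | ⟨b₀, hb₀⟩
    · simp [hempty]
    obtain ⟨A, hA, hsub⟩ := h _ hb₀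
    have hbox : Prod.mk a ⁻¹' (e.symm ⁻¹' S) ⊆ Set.univ.pi fun _ => A := by
      intro b hb j _
      simpa [e, Equiv.piEquivPiSubtypeProd, j.2] using
        hsub _ hb (fun i hi => by simp [e, Finset.mem_coe.1 hi]) j j.2
    calc Measure.pi (fun _ => μ) (Prod.mk a ⁻¹' (e.symm ⁻¹' S))
        ≤ Measure.pi (fun _ => μ) (Set.univ.pi fun _ => A) := measure_mono hbox
      _ = μ A ^ (Fintype.card ι - I.card) := by simp [Measure.pi_pi, Fintype.card_subtype_compl]
      _ ≤ c ^ (Fintype.card ι - I.card) := by gcongr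
  have hpres := (measurePreserving_piEquivPiSubtypeProd (fun _ : ι => μ) (· ∈ I)).symm
  rw [← hpres.measure_preimage_equiv, Measure.prod_apply (e.symm.measurable hS)]
  exact (lintegral_mono hfiber).trans (by simp)

variable {E ι : Type*} [NormedAddCommGroup E] [MeasurableSpace E] [Fintype ι] {μ : Measure E}

theorem pow_le_pi_notMem_convexHull_range [NormedSpace ℝ E] [SigmaFinite μ] {C : Set E}
    (hC : Convex ℝ C) {x : E} (hx : x ∉ C) :
    μ C ^ Fintype.card ι ≤
      Measure.pi (fun _ : ι => μ) {X | x ∉ convexHull ℝ (Set.range X)} := by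
  calc μ C ^ Fintype.card ι = Measure.pi (fun _ : ι => μ) (Set.univ.pi fun _ => C) := by
        simp [Measure.pi_pi]
    _ ≤ _ := measure_mono fun X hX hxX =>
        hx (convexHull_min (Set.range_subset_iff.2 fun i => hX i trivial) hC hxX)

theorem pi_notMem_convexHull_range_le [InnerProductSpace ℝ E] [FiniteDimensional ℝ E]
    [BorelSpace E] [IsProbabilityMeasure μ] [Nonempty ι]
    (hcard : Module.finrank ℝ E ≤ Fintype.card ι) {x : E} {c : ℝ≥0∞}
    (h : ∀ u : E, u ≠ 0 → μ {y | inner ℝ u y < inner ℝ u x} ≤ c) :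
    Measure.pi (fun _ : ι => μ) {X | x ∉ convexHull ℝ (Set.range X)} ≤
      (Fintype.card ι).choose (Module.finrank ℝ E) *
        c ^ (Fintype.card ι - Module.finrank ℝ E) := by
  set 𝓘 := Finset.powersetCard (Module.finrank ℝ E) (Finset.univ : Finset ι)
  have hcover : {X : ι → E | x ∉ convexHull ℝ (Set.range X)} ⊆
      ⋃ I ∈ 𝓘, nearestPointEvent x I := by
    intro X hX
    obtain ⟨I, hI, hXI⟩ := exists_mem_nearestPointEvent hcard hX
    exact Set.mem_biUnion (by simpa [𝓘] using hI) hXI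
  have hevent (I : Finset ι) :
      Measure.pi (fun _ => μ) (nearestPointEvent x I) ≤ c ^ (Fintype.card ι - I.card) := by
    refine pi_le_pow_of_forall_section (measurableSet_nearestPointEvent x I) I fun X₀ hX₀ => ?_
    obtain ⟨u, hu, hside⟩ := exists_halfspace_of_mem_nearestPointEvent hX₀
    exact ⟨_, h u hu, fun X hX hXX₀ j _ => hside X hX hXX₀ j⟩
  calc Measure.pi (fun _ => μ) {X | x ∉ convexHull ℝ (Set.range X)}
      ≤ ∑ I ∈ 𝓘, Measure.pi (fun _ => μ) (nearestPointEvent x I) :=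
        (measure_mono hcover).trans (measure_biUnion_finset_le _ _)
    _ ≤ ∑ _I ∈ 𝓘, c ^ (Fintype.card ι - Module.finrank ℝ E) :=
        Finset.sum_le_sum fun I hI => (Finset.mem_powersetCard.1 hI).2 ▸ hevent I
    _ = _ := by simp [𝓘, Finset.card_powersetCard]

end ProductMeasure

section Integral

variable {α β : Type*} [MeasurableSpace α] [MeasurableSpace β]

theorem integral_measureReal_prodMk_swap {μ : Measure α} {ν : Measure β} [IsFiniteMeasure μ]
    [IsFiniteMeasure ν] {s : Set (α × β)} (hs : MeasurableSet s) :
    ∫ y, μ.real {x | (x, y) ∈ s} ∂ν = ∫ x, ν.real {y | (x, y) ∈ s} ∂μ := by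
  have hleft : ∫ y, μ.real {x | (x, y) ∈ s} ∂ν = (μ.prod ν).real s := by
    rw [measureReal_def, Measure.prod_apply_symm hs]
    exact integral_toReal (measurable_measure_prodMk_right hs).aemeasurable (by simp)
  have hright : ∫ x, ν.real {y | (x, y) ∈ s} ∂μ = (μ.prod ν).real s := by
    rw [measureReal_def, Measure.prod_apply hs]
    exact integral_toReal (measurable_measure_prodMk_left hs).aemeasurable (by simp)
  exact hleft.trans hright.symm

theorem integral_le_measureReal_add {μ : Measure α} [IsProbabilityMeasure μ] {f : α → ℝ}
    (hf : Integrable f μ) (hf1 : ∀ x, f x ≤ 1) {s : Set α} {δ : ℝ} (hδ : 0 ≤ δ)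
    (hfs : ∀ x ∉ s, f x ≤ δ) : ∫ x, f x ∂μ ≤ μ.real s + δ := by
  set t := toMeasurable μ s
  have ht : MeasurableSet t := measurableSet_toMeasurable μ s
  have hint : Integrable (t.indicator (1 : α → ℝ)) μ := (integrable_const 1).indicator ht
  calc ∫ x, f x ∂μ ≤ ∫ x, (t.indicator (1 : α → ℝ) x + δ) ∂μ := by
        refine integral_mono hf (hint.add (integrable_const δ)) fun x => ?_
        by_cases hx : x ∈ t
        · simpa [hx] using le_add_of_le_of_nonneg (hf1 x) hδ
        · simpa [hx] using hfs x fun hxs => hx (subset_toMeasurable μ s hxs)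
    _ = μ.real s + δ := by
        rw [integral_add hint (integrable_const δ), integral_indicator_one ht, measureReal_def,
          measure_toMeasurable, integral_const]
        simp [measureReal_def]

end Integral

section Estimates

theorem one_div_four_le_one_sub_one_div_pow {n : ℕ} (hn : 2 ≤ n) :
    1 / 4 ≤ (1 - 1 / (n : ℝ)) ^ n := by
  have hn2 : (2 : ℝ) ≤ n := by exact_mod_cast hn
  have hinv : 1 / (n : ℝ) ≤ 1 := by simpa using Nat.cast_inv_le_one n
  have hbernoulli : 1 / 2 ≤ (1 - 1 / (n : ℝ)) ^ ((n : ℝ) / 2) := by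
    calc (1 : ℝ) / 2 = 1 + n / 2 * -(1 / (n : ℝ)) := by field_simp; norm_num
      _ ≤ (1 + -(1 / (n : ℝ))) ^ ((n : ℝ) / 2) :=
        one_add_mul_self_le_rpow_one_add (by linarith) (by linarith)
      _ = _ := by rw [← sub_eq_add_neg]
  calc (1 : ℝ) / 4 = (1 / 2) ^ 2 := by norm_num
    _ ≤ ((1 - 1 / (n : ℝ)) ^ ((n : ℝ) / 2)) ^ 2 := by gcongr
    _ = (1 - 1 / (n : ℝ)) ^ n := by
      rw [← Real.rpow_mul_natCast (by linarith), ← Real.rpow_natCast]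
      norm_num

theorem pow_mul_exp_neg_log_div_pow_le {d n : ℕ} (hn : 0 < n) (hd : d ≤ n) :
    (n : ℝ) ^ d * Real.exp (-(((d : ℝ) + 2) * (Real.log n / n))) ^ (n - d) ≤
      Real.exp (d * (d + 2)) / n / n := by
  have hn0 : (0 : ℝ) < n := by exact_mod_cast hn
  have hlog : Real.log n / n ≤ 1 := by
    rw [div_le_one hn0]
    exact Real.log_le_self hn0.le
  have hpow : (n : ℝ) ^ d = Real.exp (d * Real.log n) := by
    rw [Real.exp_nat_mul, Real.exp_log hn0]
  have hexponent : d * Real.log n + ((n : ℝ) - d) * -((d + 2) * (Real.log n / n)) =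
      d * (d + 2) * (Real.log n / n) - Real.log n - Real.log n := by
    field_simp
    ring
  calc (n : ℝ) ^ d * Real.exp (-(((d : ℝ) + 2) * (Real.log n / n))) ^ (n - d)
      = Real.exp (d * (d + 2) * (Real.log n / n) - Real.log n - Real.log n) := by
        rw [hpow, ← Real.exp_nat_mul, ← Real.exp_add, Nat.cast_sub hd, hexponent]
    _ ≤ Real.exp (d * (d + 2) * 1 - Real.log n - Real.log n) := by gcongr
    _ = Real.exp (d * (d + 2)) / n / n := by
        rw [Real.exp_sub, Real.exp_sub, Real.exp_log hn0, mul_one]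

theorem one_le_exp_div_div {d n : ℕ} (hn : 0 < n) (hd : n ≤ d) :
    1 ≤ Real.exp (d * (d + 2)) / n / n := by
  have hnd : (n : ℝ) ≤ d := by exact_mod_cast hd
  rw [div_div, one_le_div (by positivity)]
  nlinarith [Real.add_one_le_exp ((d : ℝ) * (d + 2))]

end Estimates

section Halfspace

variable {d : ℕ} {h : Set (EuclideanSpace ℝ (Fin d))}

theorem IsClosedHalfspace.measurableSet (hh : IsClosedHalfspace h) : MeasurableSet h := by
  obtain ⟨u, -, c, rfl⟩ := hh
  exact (isClosed_le continuous_const (by fun_prop)).measurableSet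

theorem IsClosedHalfspace.convex_compl (hh : IsClosedHalfspace h) : Convex ℝ hᶜ := by
  obtain ⟨u, -, c, rfl⟩ := hh
  have hcompl : {x : EuclideanSpace ℝ (Fin d) | c ≤ inner ℝ u x}ᶜ = {x | innerₛₗ ℝ u x < c} := by
    ext x
    simp
  exact hcompl ▸ convex_halfSpace_lt (innerₛₗ ℝ u).isLinear c

end Halfspace

section SamplePolytope

variable {d n : ℕ} {μ : Measure (EuclideanSpace ℝ (Fin d))} {x : EuclideanSpace ℝ (Fin d)} {t : ℝ}

/-- The probability that the convex hull of `n` independent points with law `μ` misses `x`. By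
Tonelli, its `μ`-average is the expected mass missed by that convex hull. -/
noncomputable def missProb (μ : Measure (EuclideanSpace ℝ (Fin d))) (n : ℕ)
    (x : EuclideanSpace ℝ (Fin d)) : ℝ :=
  (sampleLaw μ n).real {X | x ∉ samplePolytope X}

theorem missProb_nonneg : 0 ≤ missProb μ n x := measureReal_nonneg

theorem measurableSet_setOf_notMem_samplePolytope :
    MeasurableSet {q : EuclideanSpace ℝ (Fin d) × (Fin n → EuclideanSpace ℝ (Fin d)) |
      q.1 ∉ samplePolytope q.2} := by
  have hclosed : IsClosed {q : EuclideanSpace ℝ (Fin d) × (Fin n → EuclideanSpace ℝ (Fin d)) |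
      q.1 ∈ samplePolytope q.2} := by
    simpa using! isClosed_setOf_exists_mem_convexHull_range continuous_snd
      (C := {r | r.1 = r.2.1}) (isClosed_eq (by fun_prop) (by fun_prop))
  exact hclosed.isOpen_compl.measurableSet

variable [IsProbabilityMeasure μ]

instance isProbabilityMeasure_sampleLaw : IsProbabilityMeasure (sampleLaw μ n) :=
  inferInstanceAs (IsProbabilityMeasure (Measure.pi fun _ => μ))

theorem missProb_le_one : missProb μ n x ≤ 1 := measureReal_le_one

theorem one_sub_measureReal_samplePolytope (X : Fin n → EuclideanSpace ℝ (Fin d)) :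
    1 - μ.real (samplePolytope X) = μ.real {x | x ∉ samplePolytope X} :=
  (probReal_compl_eq_one_sub
    ((Set.finite_range X).isClosed_convexHull ℝ).measurableSet).symm

theorem integrable_one_sub_measureReal_samplePolytope :
    Integrable (fun X => 1 - μ.real (samplePolytope X)) (sampleLaw μ n) := by
  simp only [one_sub_measureReal_samplePolytope]
  exact Measure.integrable_measure_prodMk_left
    (measurable_swap measurableSet_setOf_notMem_samplePolytope) (measure_ne_top _ _)

theorem integrable_missProb : Integrable (missProb μ n) μ :=
  Measure.integrable_measure_prodMk_left measurableSet_setOf_notMem_samplePolytope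
    (measure_ne_top _ _)

theorem integral_one_sub_measureReal_samplePolytope :
    ∫ X, (1 - μ.real (samplePolytope X)) ∂(sampleLaw μ n) = ∫ x, missProb μ n x ∂μ := by
  simp only [one_sub_measureReal_samplePolytope]
  exact integral_measureReal_prodMk_swap measurableSet_setOf_notMem_samplePolytope

theorem one_sub_pow_le_missProb (ht : t ≤ 1) (hx : x ∈ wetPart μ t) :
    (1 - t) ^ n ≤ missProb μ n x := by
  obtain ⟨h, hh, hxh, hμ⟩ := hx
  have hsub : 1 - t ≤ μ.real hᶜ := by
    rw [probReal_compl_eq_one_sub hh.measurableSet]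
    linarith
  calc (1 - t) ^ n ≤ μ.real hᶜ ^ n := pow_le_pow_left₀ (by linarith) hsub n
    _ = (μ hᶜ ^ Fintype.card (Fin n)).toReal := by
        rw [Fintype.card_fin, ENNReal.toReal_pow, measureReal_def]
    _ ≤ missProb μ n x := ENNReal.toReal_mono (measure_ne_top _ _)
        (pow_le_pi_notMem_convexHull_range hh.convex_compl fun hxc => hxc hxh)

theorem measure_setOf_inner_lt_le_of_notMem_wetPart (hx : x ∉ wetPart μ t)
    {u : EuclideanSpace ℝ (Fin d)} (hu : u ≠ 0) :
    μ {y | inner ℝ u y < inner ℝ u x} ≤ ENNReal.ofReal (1 - t) := by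
  have hH : IsClosedHalfspace {y : EuclideanSpace ℝ (Fin d) | inner ℝ u x ≤ inner ℝ u y} :=
    ⟨u, hu, _, rfl⟩
  have ht : t < μ.real {y | inner ℝ u x ≤ inner ℝ u y} :=
    not_le.1 fun hle => hx ⟨_, hH, le_refl (inner ℝ u x), hle⟩
  have hcompl : {y | inner ℝ u y < inner ℝ u x} = {y | inner ℝ u x ≤ inner ℝ u y}ᶜ := by
    ext y
    simp
  rw [hcompl, ← ofReal_measureReal, probReal_compl_eq_one_sub hH.measurableSet]
  exact ENNReal.ofReal_le_ofReal (by linarith)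

theorem missProb_le_choose_mul_pow (hn : 0 < n) (hd : d ≤ n) (hx : x ∉ wetPart μ t) :
    missProb μ n x ≤ n.choose d * Real.exp (-t) ^ (n - d) := by
  have : Nonempty (Fin n) := ⟨⟨0, hn⟩⟩
  have hopen (u : EuclideanSpace ℝ (Fin d)) (hu : u ≠ 0) :
      μ {y | inner ℝ u y < inner ℝ u x} ≤ ENNReal.ofReal (Real.exp (-t)) :=
    (measure_setOf_inner_lt_le_of_notMem_wetPart hx hu).trans
      (ENNReal.ofReal_le_ofReal (Real.one_sub_le_exp_neg t))
  have hmiss := pi_notMem_convexHull_range_le (ι := Fin n) (by simpa using hd) hopen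
  rw [finrank_euclideanSpace_fin, Fintype.card_fin] at hmiss
  refine ENNReal.toReal_le_of_le_ofReal (by positivity) (hmiss.trans_eq ?_)
  rw [ENNReal.ofReal_mul (by positivity), ENNReal.ofReal_natCast,
    ENNReal.ofReal_pow (by positivity)]

theorem missProb_le_exp_div (hn : 0 < n)
    (hx : x ∉ wetPart μ (((d : ℝ) + 2) * (Real.log n / n))) :
    missProb μ n x ≤ Real.exp (d * (d + 2)) / n / n := by
  rcases le_total d n with hd | hd
  · calc missProb μ n x
        ≤ n.choose d * Real.exp (-(((d : ℝ) + 2) * (Real.log n / n))) ^ (n - d) :=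
          missProb_le_choose_mul_pow hn hd hx
      _ ≤ (n : ℝ) ^ d * Real.exp (-(((d : ℝ) + 2) * (Real.log n / n))) ^ (n - d) := by
          gcongr
          exact_mod_cast Nat.choose_le_pow n d
      _ ≤ Real.exp (d * (d + 2)) / n / n := pow_mul_exp_neg_log_div_pow_le hn hd
  · exact missProb_le_one.trans (one_le_exp_div_div hn hd)

theorem one_sub_pow_mul_wetMeasure_le_integral_missProb (ht : t ≤ 1) :
    (1 - t) ^ n * wetMeasure μ t ≤ ∫ x, missProb μ n x ∂μ := by
  calc (1 - t) ^ n * wetMeasure μ t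
      ≤ (1 - t) ^ n * μ.real {x | (1 - t) ^ n ≤ missProb μ n x} := by
        refine mul_le_mul_of_nonneg_left ?_ (pow_nonneg (by linarith) n)
        exact measureReal_mono fun x hx => one_sub_pow_le_missProb ht hx
    _ ≤ ∫ x, missProb μ n x ∂μ :=
        mul_meas_ge_le_integral_of_nonneg (Eventually.of_forall fun _ => missProb_nonneg)
          integrable_missProb _

end SamplePolytope

theorem theorem2 (d : ℕ) :
    ∃ ε : ℕ → ℝ, Tendsto ε atTop (𝓝 0) ∧
      ∀ (μ : Measure (EuclideanSpace ℝ (Fin d))), IsProbabilityMeasure μ →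
        ∀ n : ℕ, 2 ≤ n →
          Integrable (fun X => 1 - μ.real (samplePolytope X)) (sampleLaw μ n) ∧
          1 / 4 * wetMeasure μ (1 / (n : ℝ))
            ≤ ∫ X, (1 - μ.real (samplePolytope X)) ∂(sampleLaw μ n) ∧
          ∫ X, (1 - μ.real (samplePolytope X)) ∂(sampleLaw μ n)
            ≤ wetMeasure μ (((d : ℝ) + 2) * (Real.log n / n)) + ε n / n := by
  refine ⟨fun n => Real.exp (d * (d + 2)) / n, tendsto_const_div_atTop_nhds_zero_nat _,
    fun μ _ n hn => ⟨integrable_one_sub_measureReal_samplePolytope, ?_⟩⟩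
  rw [integral_one_sub_measureReal_samplePolytope]
  constructor
  · have hn1 : 1 / (n : ℝ) ≤ 1 := by simpa using Nat.cast_inv_le_one n
    calc 1 / 4 * wetMeasure μ (1 / (n : ℝ))
        ≤ (1 - 1 / (n : ℝ)) ^ n * wetMeasure μ (1 / (n : ℝ)) :=
          mul_le_mul_of_nonneg_right (one_div_four_le_one_sub_one_div_pow hn) measureReal_nonneg
      _ ≤ ∫ x, missProb μ n x ∂μ := one_sub_pow_mul_wetMeasure_le_integral_missProb hn1
  · exact integral_le_measureReal_add integrable_missProb (fun _ => missProb_le_one)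
      (by positivity) fun x hx => missProb_le_exp_div (by lia) hx
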